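/- Fix a natural number $d\ge 3$. Consider a two-sorted structure consisting of a set $B$ (bodies), a set $Q$ (quantities) with operations $+,\cdot$ and a relation $\le$, subsets $\mathrm{Ob},\mathrm{IOb},\mathrm{Ph}\subseteq B$ (observers, inertial observers, light signals), and a worldview relation $W\subseteq B\times B\times Q^d$, where $W(m,b,\bar x)$ is read "$m$ coordinatizes the body $b$ at $\bar x$". For $\bar x,\bar y\in Q^d$ put $$\mathsf{time}(\bar x,\bar y)=x_1-y_1,\qquad \mathsf{space}^2(\bar x,\bar y)=(x_2-y_2)^2+\dots+(x_d-y_d)^2,$$ and for $m,k,b\in B$ put $\mathsf{ev}_m(\bar x)=\{b: W(m,b,\bar x)\}$ and $\mathsf{wl}_m(b)=\{\bar x: W(m,b,\bar x)\}$. The worldview transformation $\mathsf{w}_{mk}$ is the binary relation on $Q^d$ given by $$\mathsf{w}_{mk}(\bar x,\bar y)\iff \mathsf{ev}_m(\bar x)=\mathsf{ev}_k(\bar y)\neq\emptyset .$$ A quantity $v$ is called a squared speed of $k$ according to $m$ if there are $\bar x\ne\bar y$ in $\mathsf{wl}_m(k)$ with $\mathsf{space}^2(\bar x,\bar y)=v\cdot\mathsf{time}(\bar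 x,\bar y)^2$. Assume the axiom system $\mathsf{SpecRel}$, that is: - (AxOField) $\langle Q,+,\cdot,\le\rangle$ is a (linearly) ordered field. - (AxPh) For every $m\in\mathrm{IOb}$ there is $c_m>0$ in $Q$ such that, for all $\bar x,\bar y\in Q^d$, there is $p\in\mathrm{Ph}$ with $W(m,p,\bar x)$ and $W(m,p,\bar y)$ if and only if $\mathsf{space}^2(\bar x,\bar y)=c_m^2\cdot\mathsf{time}(\bar x,\bar y)^2$. - (AxEv) For all $m,k\in\mathrm{IOb}$ and $\bar x\in Q^d$ there is $\bar y\in Q^d$ with $\mathsf{ev}_m(\bar x)=\mathsf{ev}_k(\bar y)$. - (AxSelf) For all $m\in\mathrm{IOb}$ and $\bar x\in Q^d$: $W(m,m,\bar x)$ if and only if $x_2=\dots=x_d=0$. - (AxSymD) For all $m,k\in\mathrm{IOb}$ and $\bar x,\bar y,\bar x',\bar y'\in Q^d$ with $x_1=y_1$, $x_1'=y_1'$, $\mathsf{ev}_m(\bar x)=\mathsf{ev}_k(\bar x')$ and $\mathsf{ev}_m(\bar y)=\mathsf{ev}_k(\bar y')$, we have $\mathsf{space}^2(\bar x,\bar y)=\mathsf{space}^2(\bar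 x',\bar y')$. Moreover, for every $m\in\mathrm{IOb}$ there is $p\in\mathrm{Ph}$ with $W(m,p,\langle 0,\dots,0\rangle)$ and $W(m,p,\langle 1,1,0,\dots,0\rangle)$. Let $m,k\in\mathrm{IOb}$. Then there is exactly one squared speed of $k$ according to $m$, denoted by $\mathsf{speed}^2_m(k)$, and $\mathsf{speed}^2_m(k)\neq 1$. Furthermore, if $\bar x,\bar y\in\mathsf{wl}_k(k)$ and $\bar x',\bar y'\in Q^d$ satisfy $\mathsf{w}_{km}(\bar x,\bar x')$ and $\mathsf{w}_{km}(\bar y,\bar y')$, then $$\mathsf{time}(\bar x',\bar y')^2=\frac{\mathsf{time}(\bar x,\bar y)^2}{1-\mathsf{speed}^2_m(k)} .$$ -/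

import Mathlib

/-- A structure for the two-sorted language `{B, Q; Ob, IOb, Ph, +, ·, ≤, W}` of `d`-dimensional
spacetime: `B` is the sort of bodies and `Q` the sort of quantities (whose operations and order
are supplied by type classes); `Ob`, `IOb`, `Ph` single out the observers, the inertial observers
and the light signals; `W m b x` says that `m` coordinatizes the body `b` at the coordinate point
`x`. A coordinate point is a `d`-tuple of quantities; its coordinate number `0` is the time
coordinate and all the other ones are spatial. -/
structure WorldviewModel (B Q : Type*) (d : ℕ) where
  Ob : B → Prop
  IOb : B → Prop
  Ph : B → Prop
  W : B → B → (Fin d → Q) → Prop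

/-- Time difference of two coordinate points. -/
def timeDiff {Q : Type*} [Field Q] {d : ℕ} [NeZero d] (x y : Fin d → Q) : Q :=
  x 0 - y 0

/-- Squared spatial distance of two coordinate points. -/
def spaceSq {Q : Type*} [Field Q] {d : ℕ} [NeZero d] (x y : Fin d → Q) : Q :=
  ∑ i ∈ Finset.univ.filter (fun i : Fin d => i ≠ 0), (x i - y i) ^ 2

namespace WorldviewModel

/-- The event occurring for `m` at `x`: the set of bodies which `m` coordinatizes at `x`. -/
def ev {B Q : Type*} {d : ℕ} (M : WorldviewModel B Q d) (m : B) (x : Fin d → Q) : Set B :=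
  {b | M.W m b x}

/-- The worldline of the body `b` according to `m`. -/
def wl {B Q : Type*} {d : ℕ} (M : WorldviewModel B Q d) (m b : B) : Set (Fin d → Q) :=
  {x | M.W m b x}

/-- The worldview transformation between `m` and `k`, as a binary relation. -/
def worldview {B Q : Type*} {d : ℕ} (M : WorldviewModel B Q d) (m k : B)
    (x y : Fin d → Q) : Prop :=
  M.ev m x = M.ev k y ∧ (M.ev m x).Nonempty

/-- `M.SpeedSq m k v`: the quantity `v` is a squared speed of `k` according to `m`. -/
def SpeedSq {B Q : Type*} [Field Q] {d : ℕ} [NeZero d] (M : WorldviewModel B Q d)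
    (m k : B) (v : Q) : Prop :=
  ∃ x y : Fin d → Q, x ≠ y ∧ M.W m k x ∧ M.W m k y ∧ spaceSq x y = v * timeDiff x y ^ 2

/-- For any inertial observer the speed of light is a positive quantity, the same everywhere and
in every direction, and light signals can be sent out everywhere in every direction. -/
def AxPh {B Q : Type*} [Field Q] [LinearOrder Q] {d : ℕ} [NeZero d]
    (M : WorldviewModel B Q d) : Prop :=
  ∀ m, M.IOb m → ∃ c : Q, 0 < c ∧ ∀ x y : Fin d → Q,
    (∃ p, M.Ph p ∧ M.W m p x ∧ M.W m p y) ↔ spaceSq x y = c ^ 2 * timeDiff x y ^ 2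

/-- All inertial observers coordinatize the same set of events. -/
def AxEv {B Q : Type*} {d : ℕ} (M : WorldviewModel B Q d) : Prop :=
  ∀ m k, M.IOb m → M.IOb k → ∀ x : Fin d → Q, ∃ y : Fin d → Q,
    ∀ b, M.W m b x ↔ M.W k b y

/-- Any inertial observer is stationary, at the spatial origin, relative to himself. -/
def AxSelf {B Q : Type*} [Field Q] {d : ℕ} [NeZero d] (M : WorldviewModel B Q d) : Prop :=
  ∀ m, M.IOb m → ∀ x : Fin d → Q, M.W m m x ↔ ∀ i, i ≠ 0 → x i = 0

/-- Any two inertial observers agree as to the spatial distance between two events which are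
simultaneous for both of them; and every inertial observer coordinatizes a light signal at the
origin and at the point `⟨1, 1, 0, …, 0⟩`. -/
def AxSymD {B Q : Type*} [Field Q] {d : ℕ} [NeZero d] (M : WorldviewModel B Q d) : Prop :=
  (∀ m k, M.IOb m → M.IOb k → ∀ x y x' y' : Fin d → Q,
    x 0 = y 0 → x' 0 = y' 0 → M.ev m x = M.ev k x' → M.ev m y = M.ev k y' →
      spaceSq x y = spaceSq x' y') ∧
  (∀ m, M.IOb m → ∃ p, M.Ph p ∧ M.W m p (fun _ => 0) ∧
    M.W m p (fun i => if i.val ≤ 1 then 1 else 0))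

/-- The axiom system of special relativity. The remaining axiom, that the quantities form an
ordered field, is expressed by the type classes. -/
structure SpecRel {B Q : Type*} [Field Q] [LinearOrder Q] [IsStrictOrderedRing Q]
    {d : ℕ} [NeZero d] (M : WorldviewModel B Q d) : Prop where
  axPh : M.AxPh
  axEv : M.AxEv
  axSelf : M.AxSelf
  axSymD : M.AxSymD

end WorldviewModel

open Finset

/-! The formula follows once the map `f` sending `k`'s coordinates to `m`'s is known to be a
Poincaré transformation. Let `T` be the image of `k`'s unit time vector under its linear part. Then
`T` has Minkowski square `-1`, and `f` turns a time lapse `t` on `k`'s own worldline into the vector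
`t • T`. So `m` measures time `t * T 0` and squared distance `t ^ 2 * (T 0 ^ 2 - 1)`; hence the
squared speed is `1 - 1 / T 0 ^ 2`, and `T 0 ^ 2 = 1 / (1 - v)`.

That `f` is Poincaré is an Alexandrov–Zeeman theorem over an arbitrary ordered field, where square
roots may be missing. The photon axioms make `f` a surjection preserving lightlike separation both
ways. Such a map sends parallelograms with null sides to parallelograms
(`PreservesNull.apply_add_add`), so it is additive up to translation (`PreservesNull.apply_add`). An
additive map of this kind is semilinear (`PreservesNull.exists_ringHom`) and scales the form
(`PreservesNull.exists_minkowski_map`). The symmetry axiom finally forces the field homomorphism to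
be the identity and the scale to be `1` (`PreservesNull.isLorentz`). -/

/-- The Minkowski bilinear form, with the time coordinate negative. -/
def minkowski (Q : Type*) [Field Q] (d : ℕ) [NeZero d] : LinearMap.BilinForm Q (Fin d → Q) :=
  LinearMap.mk₂ Q
    (fun x y => ∑ i ∈ univ.filter (fun i : Fin d => i ≠ 0), x i * y i - x 0 * y 0)
    (fun x x' y => by simp only [Pi.add_apply, add_mul, sum_add_distrib]; ring)
    (fun c x y => by simp only [Pi.smul_apply, smul_eq_mul, mul_sub, mul_sum, mul_assoc])
    (fun x y y' => by simp only [Pi.add_apply, mul_add, sum_add_distrib]; ring)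
    (fun c x y => by
      simp only [Pi.smul_apply, smul_eq_mul, mul_sub, mul_sum, mul_left_comm])

/-! ### Null vectors of the Minkowski form. -/

section Form

variable {Q : Type*} [Field Q] {d : ℕ} [NeZero d]

theorem minkowski_apply (x y : Fin d → Q) : minkowski Q d x y =
    ∑ i ∈ univ.filter (fun i : Fin d => i ≠ 0), x i * y i - x 0 * y 0 := rfl

theorem minkowski_comm (x y : Fin d → Q) : minkowski Q d x y = minkowski Q d y x := by
  simp only [minkowski_apply, mul_comm]

theorem minkowski_single_zero (a : Q) (x : Fin d → Q) :
    minkowski Q d (Pi.single 0 a) x = -(a * x 0) := by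
  rw [minkowski_apply, sum_eq_zero]
  · simp
  · intro i hi
    simp [Pi.single_eq_of_ne (mem_filter.1 hi).2]

theorem minkowski_single_of_ne {i : Fin d} (hi : i ≠ 0) (a : Q) (x : Fin d → Q) :
    minkowski Q d (Pi.single i a) x = a * x i := by
  rw [minkowski_apply, sum_eq_single_of_mem i (by simp [hi])]
  · simp [Pi.single_eq_of_ne hi.symm]
  · intro j _ hj
    simp [Pi.single_eq_of_ne hj]

theorem spaceSq_eq (x y : Fin d → Q) :
    spaceSq x y = minkowski Q d (x - y) (x - y) + timeDiff x y ^ 2 := by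
  simp only [spaceSq, timeDiff, minkowski_apply, Pi.sub_apply, pow_two]
  ring

theorem minkowski_add_self (x y : Fin d → Q) : minkowski Q d (x + y) (x + y) =
    minkowski Q d x x + minkowski Q d y y + 2 * minkowski Q d x y := by
  simp only [map_add, LinearMap.add_apply, minkowski_comm y x]
  ring

theorem minkowski_sub_self (x y : Fin d → Q) : minkowski Q d (x - y) (x - y) =
    minkowski Q d x x + minkowski Q d y y - 2 * minkowski Q d x y := by
  simp only [map_sub, LinearMap.sub_apply, minkowski_comm y x]
  ring

theorem minkowski_neg_self (x : Fin d → Q) :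
    minkowski Q d (-x) (-x) = minkowski Q d x x := by
  simp

theorem minkowski_sub_self_comm (x y : Fin d → Q) :
    minkowski Q d (x - y) (x - y) = minkowski Q d (y - x) (y - x) := by
  rw [← neg_sub, minkowski_neg_self]

theorem minkowski_smul_self (c : Q) (x : Fin d → Q) :
    minkowski Q d (c • x) (c • x) = c ^ 2 * minkowski Q d x x := by
  simp only [map_smul, LinearMap.smul_apply, smul_eq_mul]
  ring

theorem minkowski_single_add_single {i : Fin d} (hi : i ≠ 0) (a : Q) :
    minkowski Q d (Pi.single 0 a + Pi.single i a) (Pi.single 0 a + Pi.single i a) = 0 := by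
  simp [minkowski_single_zero, minkowski_single_of_ne hi, Pi.single_eq_of_ne hi,
    Pi.single_eq_of_ne hi.symm]

theorem minkowski_single_sub_single {i : Fin d} (hi : i ≠ 0) (a : Q) :
    minkowski Q d (Pi.single 0 a - Pi.single i a) (Pi.single 0 a - Pi.single i a) = 0 := by
  simp [minkowski_single_zero, minkowski_single_of_ne hi, Pi.single_eq_of_ne hi,
    Pi.single_eq_of_ne hi.symm]

theorem minkowski_add_single (i : Fin d) (hi : i ≠ 0) (a : Q) (w : Fin d → Q) :
    minkowski Q d (Pi.single 0 a + Pi.single i a) w = a * (w i - w 0) := by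
  simp only [map_add, LinearMap.add_apply, minkowski_single_zero, minkowski_single_of_ne hi]
  ring

theorem minkowski_sub_single (i : Fin d) (hi : i ≠ 0) (a : Q) (w : Fin d → Q) :
    minkowski Q d (Pi.single 0 a - Pi.single i a) w = -(a * (w i + w 0)) := by
  simp only [map_sub, LinearMap.sub_apply, minkowski_single_zero, minkowski_single_of_ne hi]
  ring

omit [NeZero d] in
theorem mem_of_forall_single_mem (S : AddSubgroup (Fin d → Q))
    (h : ∀ i a, Pi.single i a ∈ S) (x : Fin d → Q) : x ∈ S := by
  rw [← Finset.univ_sum_single x]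
  exact sum_mem fun i _ => h i _

theorem exists_two_ne_zero (hd : 3 ≤ d) : ∃ i j : Fin d, i ≠ 0 ∧ j ≠ 0 ∧ i ≠ j := by
  refine ⟨⟨1, by omega⟩, ⟨2, by omega⟩, ?_, ?_, ?_⟩ <;> simp [Fin.ext_iff]

theorem exists_ne_zero_ne (hd : 3 ≤ d) (i : Fin d) : ∃ j : Fin d, j ≠ 0 ∧ i ≠ j := by
  obtain ⟨j, l, hj, hl, hjl⟩ := exists_two_ne_zero hd
  by_cases h : i = j
  · exact ⟨l, hl, h ▸ hjl⟩
  · exact ⟨j, hj, h⟩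

variable [LinearOrder Q] [IsStrictOrderedRing Q]

/-- A purely spatial vector has positive square. -/
theorem minkowski_self_pos {x : Fin d → Q} (hx : x ≠ 0) (h0 : x 0 = 0) :
    0 < minkowski Q d x x := by
  rw [minkowski_apply, h0, mul_zero, sub_zero]
  obtain ⟨i, hi⟩ := Function.ne_iff.1 hx
  have hi0 : i ≠ 0 := by rintro rfl; exact hi h0
  exact sum_pos' (fun j _ => mul_self_nonneg _) ⟨i, by simp [hi0], mul_self_pos.2 hi⟩

theorem apply_zero_ne_zero_of_null {x : Fin d → Q} (hx : x ≠ 0) (h : minkowski Q d x x = 0) :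
    x 0 ≠ 0 := fun h0 => (minkowski_self_pos hx h0).ne' h

/-- Orthogonal null vectors are parallel. -/
theorem exists_smul_of_null {x y : Fin d → Q} (hx : x ≠ 0) (hxx : minkowski Q d x x = 0)
    (hyy : minkowski Q d y y = 0) (hxy : minkowski Q d x y = 0) : ∃ c : Q, y = c • x := by
  have h0 := apply_zero_ne_zero_of_null hx hxx
  refine ⟨y 0 / x 0, ?_⟩
  by_contra hne
  refine (minkowski_self_pos (sub_ne_zero.2 hne) ?_).ne' ?_
  · simp [div_mul_cancel₀ _ h0]
  · rw [minkowski_sub_self, minkowski_smul_self, hxx, hyy, map_smul, smul_eq_mul,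
      minkowski_comm, hxy]
    ring

theorem sq_add_sq_le_of_null {w : Fin d → Q} (h : minkowski Q d w w = 0) {i j : Fin d}
    (hi : i ≠ 0) (hj : j ≠ 0) (hij : i ≠ j) : w i ^ 2 + w j ^ 2 ≤ w 0 ^ 2 := by
  have h1 : ∑ l ∈ ({i, j} : Finset (Fin d)), w l * w l ≤
      ∑ l ∈ univ.filter (fun i : Fin d => i ≠ 0), w l * w l :=
    sum_le_sum_of_subset_of_nonneg (by
      intro l hl
      simp only [mem_insert, mem_singleton] at hl
      rcases hl with rfl | rfl <;> simp [hi, hj]) fun l _ _ => mul_self_nonneg _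
  rw [sum_pair hij] at h1
  rw [minkowski_apply] at h
  linarith [sq (w i), sq (w j), sq (w 0)]

/-- Two spatial coordinates cannot both have square `w 0 ^ 2`, since their squares add up to at most
that. With a single spatial dimension this fails. -/
theorem exists_sq_ne_of_null (hd : 3 ≤ d) {w : Fin d → Q} (hw : w ≠ 0)
    (h : minkowski Q d w w = 0) : ∃ i : Fin d, i ≠ 0 ∧ w 0 ^ 2 ≠ w i ^ 2 := by
  obtain ⟨i, j, hi, hj, hij⟩ := exists_two_ne_zero hd
  have h1 := sq_add_sq_le_of_null h hi hj hij
  have h2 : 0 < w 0 ^ 2 := sq_pos_of_ne_zero (apply_zero_ne_zero_of_null hw h)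
  by_cases h3 : w 0 ^ 2 = w i ^ 2
  · exact ⟨j, hj, by intro h4; linarith⟩
  · exact ⟨i, hi, h3⟩

/-- The null vectors which are not parallel to a given one generate the whole space. -/
theorem mem_of_forall_null_mem (hd : 3 ≤ d) {w : Fin d → Q} (hw : w ≠ 0)
    (hww : minkowski Q d w w = 0) (S : AddSubgroup (Fin d → Q))
    (h : ∀ x, minkowski Q d x x = 0 → minkowski Q d x w ≠ 0 → x ∈ S) (x : Fin d → Q) :
    x ∈ S := by
  -- `S` is closed under addition only, because the maps studied later are not yet known to respect
  -- scalars; hence every multiple `a` is treated.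
  have hp : ∀ (i : Fin d) (a : Q), i ≠ 0 → w 0 ≠ w i → Pi.single 0 a + Pi.single i a ∈ S := by
    intro i a hi hne
    by_cases ha : a = 0
    · simp [ha]
    · refine h _ (minkowski_single_add_single hi a) ?_
      rw [minkowski_add_single i hi]
      exact mul_ne_zero ha (sub_ne_zero.2 hne.symm)
  have hq : ∀ (i : Fin d) (a : Q), i ≠ 0 → w 0 ≠ -w i → Pi.single 0 a - Pi.single i a ∈ S := by
    intro i a hi hne
    by_cases ha : a = 0
    · simp [ha]
    · refine h _ (minkowski_single_sub_single hi a) ?_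
      rw [minkowski_sub_single i hi]
      refine neg_ne_zero.2 (mul_ne_zero ha fun h => hne (by linear_combination h))
  -- For a coordinate `i` with `w i ^ 2 ≠ w 0 ^ 2` both null vectors `e₀ ± eᵢ` are admissible, and
  -- they sum to `2 e₀`. For any other spatial `i` one of the two suffices, once `e₀` is available.
  have h0 : ∀ a : Q, Pi.single 0 a ∈ S := by
    intro a
    obtain ⟨i, hi, hne⟩ := exists_sq_ne_of_null hd hw hww
    have h1 := S.add_mem (hp i (a / 2) hi fun h => hne (by rw [h]))
      (hq i (a / 2) hi fun h => hne (by rw [h, neg_sq]))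
    rwa [add_add_sub_cancel, ← Pi.single_add, add_halves] at h1
  refine mem_of_forall_single_mem S (fun i a => ?_) x
  by_cases hi : i = 0
  · exact hi ▸ h0 a
  by_cases hne : w 0 = w i
  · have hne' : w 0 ≠ -w i := fun h' =>
      apply_zero_ne_zero_of_null hw hww (by linarith)
    have h1 := S.sub_mem (h0 a) (hq i a hi hne')
    rwa [sub_sub_cancel] at h1
  · have h1 := S.sub_mem (hp i a hi hne) (h0 a)
    rwa [add_sub_cancel_left] at h1

/-- Otherwise the generation lemma, vacuously applied to the trivial subgroup, would give `w = 0`.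
-/
theorem exists_null_minkowski_ne_zero (hd : 3 ≤ d) {w : Fin d → Q} (hw : w ≠ 0)
    (hww : minkowski Q d w w = 0) :
    ∃ x, minkowski Q d x x = 0 ∧ minkowski Q d x w ≠ 0 := by
  by_contra! h
  exact hw ((AddSubgroup.mem_bot).1
    (mem_of_forall_null_mem hd hw hww ⊥ (fun x h1 h2 => absurd (h x h1) h2) w))

/-- A point is determined by its light cone. -/
theorem eq_of_forall_null_iff (hd : 3 ≤ d) {x y : Fin d → Q}
    (h : ∀ z, minkowski Q d (x - z) (x - z) = 0 ↔ minkowski Q d (y - z) (y - z) = 0) :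
    x = y := by
  by_contra hne
  have hxy : minkowski Q d (x - y) (x - y) = 0 := (h y).2 (by simp)
  -- The point `x + n` lies on the cone of `x` but not on that of `y`: the square of `n + (x - y)`
  -- is twice the product of `n` and `x - y`.
  obtain ⟨n, hn, hnw⟩ := exists_null_minkowski_ne_zero hd (sub_ne_zero.2 hne) hxy
  have h1 := (h (x + n)).1 (by simpa using hn)
  rw [minkowski_sub_self_comm, show x + n - y = n + (x - y) by abel, minkowski_add_self, hn,
    hxy] at h1
  exact hnw (by linarith)

end Form

/-! ### Maps preserving lightlike separation are additive up to translation. -/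

/-- A surjection which preserves lightlike separation in both directions. -/
structure PreservesNull {Q : Type*} [Field Q] {d : ℕ} [NeZero d]
    (f : (Fin d → Q) → (Fin d → Q)) : Prop where
  surjective : Function.Surjective f
  null_iff : ∀ x y, minkowski Q d (f x - f y) (f x - f y) = 0 ↔ minkowski Q d (x - y) (x - y) = 0

namespace PreservesNull

variable {Q : Type*} [Field Q] [LinearOrder Q] [IsStrictOrderedRing Q] {d : ℕ} [NeZero d]
  {f : (Fin d → Q) → (Fin d → Q)}

theorem injective (hf : PreservesNull f) (hd : 3 ≤ d) : Function.Injective f := fun x y h =>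
  eq_of_forall_null_iff hd fun z => by rw [← hf.null_iff x, ← hf.null_iff y, h]

/-- Points of the image of a light line come from points of that light line. -/
theorem exists_apply_eq_add_smul (hf : PreservesNull f) {o u : Fin d → Q} (hu : u ≠ 0)
    (huu : minkowski Q d u u = 0) (c : Q) :
    ∃ b : Q, f (o + b • u) = f o + c • (f (o + u) - f o) := by
  obtain ⟨z, hz⟩ := hf.surjective (f o + c • (f (o + u) - f o))
  have h0 : minkowski Q d (f (o + u) - f o) (f (o + u) - f o) = 0 := by
    rw [hf.null_iff]; simpa using huu
  have h1 : minkowski Q d (z - o) (z - o) = 0 := by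
    rw [← hf.null_iff, hz, add_sub_cancel_left, minkowski_smul_self, h0, mul_zero]
  have h2 : minkowski Q d (z - (o + u)) (z - (o + u)) = 0 := by
    rw [← hf.null_iff, hz, show f o + c • (f (o + u) - f o) - f (o + u) =
      (c - 1) • (f (o + u) - f o) by module, minkowski_smul_self, h0, mul_zero]
  rw [← sub_sub, minkowski_sub_self, h1, huu] at h2
  obtain ⟨b, hb⟩ := exists_smul_of_null hu huu h1 (by rw [minkowski_comm]; linarith)
  exact ⟨b, by rw [← hb, add_sub_cancel, hz]⟩

/-- Light lines are mapped to light lines. -/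
theorem exists_apply_add_smul_eq (hf : PreservesNull f) (hd : 3 ≤ d) {o u : Fin d → Q}
    (hu : u ≠ 0) (huu : minkowski Q d u u = 0) (b : Q) :
    ∃ c : Q, f (o + b • u) = f o + c • (f (o + u) - f o) := by
  have h0 : minkowski Q d (f (o + u) - f o) (f (o + u) - f o) = 0 := by
    rw [hf.null_iff]; simpa using huu
  have h1 : minkowski Q d (f (o + b • u) - f o) (f (o + b • u) - f o) = 0 := by
    rw [hf.null_iff, add_sub_cancel_left, minkowski_smul_self, huu, mul_zero]
  have h2 : minkowski Q d (f (o + b • u) - f (o + u)) (f (o + b • u) - f (o + u)) = 0 := by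
    rw [hf.null_iff, show o + b • u - (o + u) = (b - 1) • u by module, minkowski_smul_self, huu,
      mul_zero]
  have hne : f (o + u) - f o ≠ 0 :=
    sub_ne_zero.2 fun h => hu (by simpa using hf.injective hd h)
  rw [← sub_sub_sub_cancel_right _ _ (f o), minkowski_sub_self, h1, h0] at h2
  obtain ⟨c, hc⟩ := exists_smul_of_null hne h0 h1 (by rw [minkowski_comm]; linarith)
  exact ⟨c, by rw [← hc, add_sub_cancel]⟩

/-- Parallel light lines in a common timelike plane have parallel images. -/
theorem exists_smul_sub (hf : PreservesNull f) (hd : 3 ≤ d) {o u w : Fin d → Q}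
    (hu : minkowski Q d u u = 0) (hw : minkowski Q d w w = 0) (huw : minkowski Q d u w ≠ 0) :
    ∃ c : Q, f (o + u + w) - f (o + w) = c • (f (o + u) - f o) := by
  have hu0 : u ≠ 0 := by rintro rfl; simp at huw
  have hU : minkowski Q d (f (o + u) - f o) (f (o + u) - f o) = 0 := by
    rw [hf.null_iff]; simpa using hu
  have hV : minkowski Q d (f (o + w) - f o) (f (o + w) - f o) = 0 := by
    rw [hf.null_iff]; simpa using hw
  have hU' : minkowski Q d (f (o + w + u) - f (o + w)) (f (o + w + u) - f (o + w)) = 0 := by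
    rw [hf.null_iff]; simpa using hu
  have hBD : minkowski Q d (f (o + w) - f (o + u)) (f (o + w) - f (o + u)) ≠ 0 := by
    rw [Ne, hf.null_iff, add_sub_add_left_eq_sub, minkowski_sub_self, hu, hw, minkowski_comm]
    simpa using huw
  have hAC : minkowski Q d (f (o + w + u) - f o) (f (o + w + u) - f o) ≠ 0 := by
    rw [Ne, hf.null_iff, add_assoc, add_sub_cancel_left, minkowski_add_self, hu, hw,
      minkowski_comm]
    simpa using huw
  -- Each point of the first image line is lightlike to some point of the second, because this holds
  -- for the original lines via translation by `w`.
  have key : ∀ b : Q, ∃ c : Q, minkowski Q d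
      (f (o + w) - f o + c • (f (o + w + u) - f (o + w)) - b • (f (o + u) - f o))
      (f (o + w) - f o + c • (f (o + w + u) - f (o + w)) - b • (f (o + u) - f o)) = 0 := by
    intro b
    obtain ⟨b', hb'⟩ := hf.exists_apply_eq_add_smul (o := o) hu0 hu b
    obtain ⟨c, hc⟩ := hf.exists_apply_add_smul_eq hd (o := o + w) hu0 hu b'
    refine ⟨c, ?_⟩
    have h := (hf.null_iff (o + w + b' • u) (o + b' • u)).2 (by
      rw [show o + w + b' • u - (o + b' • u) = w by abel]; exact hw)
    rw [hc, hb'] at h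
    rwa [show f (o + w) - f o + c • (f (o + w + u) - f (o + w)) - b • (f (o + u) - f o) =
      f (o + w) + c • (f (o + w + u) - f (o + w)) - (f o + b • (f (o + u) - f o)) by abel]
  have hUne : f (o + u) - f o ≠ 0 :=
    sub_ne_zero.2 fun h => hu0 (by simpa using hf.injective hd h)
  rw [← sub_sub_sub_cancel_right _ _ (f o), minkowski_sub_self, hV, hU] at hBD
  rw [show f (o + w + u) - f o = f (o + w) - f o + (f (o + w + u) - f (o + w)) by abel,
    minkowski_add_self, hV, hU'] at hAC
  rw [show o + u + w = o + w + u by abel]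
  generalize f (o + w + u) - f (o + w) = U' at *
  generalize f (o + w) - f o = V at *
  generalize f (o + u) - f o = U at *
  refine exists_smul_of_null hUne hU hU' ?_
  by_contra hUU'
  have hVU : minkowski Q d V U ≠ 0 := fun h => hBD (by rw [h]; ring)
  have hVU' : minkowski Q d V U' ≠ 0 := fun h => hAC (by rw [h]; ring)
  -- The square in `key` is `2 (c⟨V,U'⟩ - b⟨V,U⟩ - b c⟨U,U'⟩)`. Taking `b = r` removes `c` and
  -- leaves `-2 r⟨V,U⟩ ≠ 0`, so this point of the first line would have no partner.
  obtain ⟨r, hr⟩ : ∃ r, r * minkowski Q d U U' = minkowski Q d V U' :=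
    ⟨_, div_mul_cancel₀ _ hUU'⟩
  have hr0 : r ≠ 0 := by rintro rfl; exact hVU' (by rw [← hr, zero_mul])
  obtain ⟨c, hc⟩ := key r
  rw [minkowski_sub_self, minkowski_add_self, minkowski_smul_self, minkowski_smul_self, hU, hU',
    hV] at hc
  simp only [map_add, map_smul, LinearMap.add_apply, LinearMap.smul_apply, smul_eq_mul,
    minkowski_comm U' U] at hc
  exact mul_ne_zero hr0 hVU (by linear_combination (-1 / 2) * hc - c * hr)

/-- Parallelograms with null sides are mapped to parallelograms. -/
theorem apply_add_add (hf : PreservesNull f) (hd : 3 ≤ d) {o u w : Fin d → Q}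
    (hu : minkowski Q d u u = 0) (hw : minkowski Q d w w = 0) (huw : minkowski Q d u w ≠ 0) :
    f (o + u + w) - f (o + u) = f (o + w) - f o := by
  obtain ⟨c, hc⟩ := hf.exists_smul_sub hd (o := o) hu hw huw
  obtain ⟨e, he⟩ := hf.exists_smul_sub hd (o := o) hw hu (by rwa [minkowski_comm])
  rw [add_right_comm] at he
  have hU : minkowski Q d (f (o + u) - f o) (f (o + u) - f o) = 0 := by
    rw [hf.null_iff]; simpa using hu
  have hV : minkowski Q d (f (o + w) - f o) (f (o + w) - f o) = 0 := by
    rw [hf.null_iff]; simpa using hw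
  have hBD : minkowski Q d (f (o + w) - f (o + u)) (f (o + w) - f (o + u)) ≠ 0 := by
    rw [Ne, hf.null_iff, add_sub_add_left_eq_sub, minkowski_sub_self, hu, hw, minkowski_comm]
    simpa using huw
  rw [← sub_sub_sub_cancel_right _ _ (f o), minkowski_sub_self, hV, hU] at hBD
  -- Both routes to the fourth vertex agree; pairing with the null vector `f (o + u) - f o` then
  -- forces `e = 1`.
  have h : (1 - e) • (f (o + w) - f o) = (1 - c) • (f (o + u) - f o) := by
    rw [sub_smul, sub_smul, ← hc, ← he]
    module
  rw [he]
  have h2 := congrArg (fun x => minkowski Q d x (f (o + u) - f o)) h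
  simp only [map_smul, LinearMap.smul_apply, hU, smul_eq_mul, mul_zero] at h2
  rcases mul_eq_zero.1 h2 with h3 | h3
  · rw [← sub_eq_zero.1 h3, one_smul]
  · exact absurd (by rw [h3]; ring) hBD

/-- The translations that leave the increment along `w` unchanged form a subgroup. By the
parallelogram lemma it contains every null vector not orthogonal to `w`, and these generate the
space. -/
theorem apply_add_sub_eq_of_null (hf : PreservesNull f) (hd : 3 ≤ d) {w : Fin d → Q}
    (hw : minkowski Q d w w = 0) (x : Fin d → Q) : ∀ o, f (o + x + w) - f (o + x) =
      f (o + w) - f o := by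
  by_cases hw0 : w = 0
  · simp [hw0]
  let S : AddSubgroup (Fin d → Q) :=
    { carrier := {x | ∀ o, f (o + x + w) - f (o + x) = f (o + w) - f o}
      zero_mem' := by simp
      add_mem' := fun {x y} hx hy o => by rw [← hx o, ← hy (o + x), ← add_assoc]
      neg_mem' := fun {x} hx o => by rw [← hx (o + -x), neg_add_cancel_right] }
  exact mem_of_forall_null_mem hd hw0 hw S (fun y hy hyw o => hf.apply_add_add hd hy hw hyw) x

/-- The vectors whose increment does not depend on the base point form a subgroup containing all
null vectors. -/
theorem apply_add (hf : PreservesNull f) (hd : 3 ≤ d) (x y : Fin d → Q) :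
    f (x + y) - f 0 = (f x - f 0) + (f y - f 0) := by
  let S : AddSubgroup (Fin d → Q) :=
    { carrier := {y | ∀ o, f (o + y) - f o = f y - f 0}
      zero_mem' := by simp
      add_mem' := fun {x y} hx hy o => by
        have h1 := hx o
        have h2 := hy (o + x)
        have h3 := hy x
        rw [← add_assoc]
        linear_combination (exp := 1) h1 + h2 - h3
      neg_mem' := fun {x} hx o => by
        have h1 := hx (o + -x)
        have h2 := hx (-x)
        rw [neg_add_cancel_right] at h1
        rw [neg_add_cancel] at h2
        linear_combination (exp := 1) h2 - h1 }
  have hS : ∀ y, minkowski Q d y y = 0 → y ∈ S := fun y hy o => by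
    have := hf.apply_add_sub_eq_of_null hd hy o 0
    rwa [zero_add, zero_add] at this
  have hy : y ∈ S := by
    obtain ⟨i, hi, -⟩ := exists_ne_zero_ne hd 0
    have hw := minkowski_single_add_single (d := d) hi (1 : Q)
    refine mem_of_forall_null_mem hd (fun h => ?_) hw S (fun y hy _ => hS y hy) y
    simpa [Pi.single_eq_of_ne hi.symm] using congrFun h 0
  linear_combination (exp := 1) hy x

/-- The additive part of a map preserving lightlike separation. -/
def addHom (hf : PreservesNull f) (hd : 3 ≤ d) : (Fin d → Q) →+ (Fin d → Q) where
  toFun x := f x - f 0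
  map_zero' := sub_self _
  map_add' := hf.apply_add hd

theorem addHom_apply (hf : PreservesNull f) (hd : 3 ≤ d) (x : Fin d → Q) :
    hf.addHom hd x = f x - f 0 := rfl

theorem apply_sub_apply (hf : PreservesNull f) (hd : 3 ≤ d) (x y : Fin d → Q) :
    f x - f y = hf.addHom hd (x - y) := by
  rw [map_sub, addHom_apply, addHom_apply, sub_sub_sub_cancel_right]

theorem addHom_null_iff (hf : PreservesNull f) (hd : 3 ≤ d) (x : Fin d → Q) :
    minkowski Q d (hf.addHom hd x) (hf.addHom hd x) = 0 ↔ minkowski Q d x x = 0 := by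
  rw [addHom_apply, hf.null_iff, sub_zero]

theorem addHom_preservesNull (hf : PreservesNull f) (hd : 3 ≤ d) :
    PreservesNull (hf.addHom hd) where
  surjective y := (hf.surjective (y + f 0)).imp fun x hx => by
    rw [addHom_apply, hx, add_sub_cancel_right]
  null_iff x y := by rw [← map_sub, hf.addHom_null_iff]

end PreservesNull

/-! ### Additive maps preserving lightlike separation: semilinearity and the Lorentz property. -/

namespace PreservesNull

variable {Q : Type*} [Field Q] [LinearOrder Q] [IsStrictOrderedRing Q] {d : ℕ} [NeZero d]
  {g : (Fin d → Q) →+ (Fin d → Q)}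

omit [LinearOrder Q] [IsStrictOrderedRing Q] in
theorem map_null_iff (hg : PreservesNull g) (x : Fin d → Q) :
    minkowski Q d (g x) (g x) = 0 ↔ minkowski Q d x x = 0 := by
  simpa using hg.null_iff x 0

/-- Null vectors of the form `u ± v` have images with this property. -/
theorem map_self_add_map_self (hg : PreservesNull g) {x y : Fin d → Q}
    (h1 : minkowski Q d (x + y) (x + y) = 0) (h2 : minkowski Q d (x - y) (x - y) = 0) :
    minkowski Q d (g x) (g x) + minkowski Q d (g y) (g y) = 0 ∧
      minkowski Q d (g x) (g y) = 0 := by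
  rw [← hg.map_null_iff, map_add, minkowski_add_self] at h1
  rw [← hg.map_null_iff, map_sub, minkowski_sub_self] at h2
  constructor <;> linarith

theorem exists_map_smul_of_null (hg : PreservesNull g) (hd : 3 ≤ d) {u : Fin d → Q}
    (hu : minkowski Q d u u = 0) (b : Q) : ∃ c : Q, g (b • u) = c • g u := by
  by_cases hu0 : u = 0
  · exact ⟨0, by simp [hu0]⟩
  · simpa using hg.exists_apply_add_smul_eq hd (o := 0) hu0 hu b

theorem minkowski_map_single_zero_ne_zero (hg : PreservesNull g) :
    minkowski Q d (g (Pi.single 0 1)) (g (Pi.single 0 1)) ≠ 0 := by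
  rw [Ne, hg.map_null_iff, minkowski_single_zero]
  simp

theorem map_single_zero_ne_zero (hg : PreservesNull g) : g (Pi.single 0 1) ≠ 0 := fun h =>
  hg.minkowski_map_single_zero_ne_zero (by rw [h]; simp)

theorem minkowski_map_single (hg : PreservesNull g) {i : Fin d} (hi : i ≠ 0) (a : Q) :
    minkowski Q d (g (Pi.single 0 a)) (g (Pi.single 0 a)) +
        minkowski Q d (g (Pi.single i a)) (g (Pi.single i a)) = 0 ∧
      minkowski Q d (g (Pi.single 0 a)) (g (Pi.single i a)) = 0 :=
  hg.map_self_add_map_self (minkowski_single_add_single hi a) (minkowski_single_sub_single hi a)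

/-- If `s` is the factor by which `g` scales one of the null vectors `e₀ ± eᵢ` when that vector is
multiplied by `r ^ 2`, then `s` is the ratio of the squares of the images of `r • eⱼ` and `eⱼ`. -/
theorem minkowski_map_single_eq_mul (hg : PreservesNull g) {i j : Fin d} (hi : i ≠ 0) (hj : j ≠ 0)
    (hij : i ≠ j) {e : Q} (he : e ^ 2 = 1) {r s : Q}
    (hs : g (Pi.single 0 (r ^ 2) + Pi.single i (e * r ^ 2)) =
      s • g (Pi.single 0 1 + Pi.single i e)) :
    minkowski Q d (g (Pi.single j (2 * r))) (g (Pi.single j (2 * r))) =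
      - (s * (4 * minkowski Q d (g (Pi.single 0 1)) (g (Pi.single 0 1)))) := by
  have hi' := hi.symm
  have hj' := hj.symm
  have hij' := hij.symm
  -- The square of `p + q` is `(r² - 1)² - (r² + 1)² = -(2r)²`, so `p + q ± 2r eⱼ` are null, with no
  -- square root needed.
  set p : Fin d → Q := Pi.single 0 (r ^ 2) + Pi.single i (e * r ^ 2) with hp
  set q : Fin d → Q := Pi.single 0 1 - Pi.single i e with hq
  have h := (hg.map_self_add_map_self (x := p + q) (y := Pi.single j (2 * r))
    (by
      simp [hp, hq, minkowski_single_zero, minkowski_single_of_ne, hi, hj, hi', hj', hij, hij']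
      linear_combination (r ^ 2 - 1) ^ 2 * he)
    (by
      simp [hp, hq, minkowski_single_zero, minkowski_single_of_ne, hi, hj, hi', hj', hij, hij']
      linear_combination (r ^ 2 - 1) ^ 2 * he)).1
  have hpp : minkowski Q d (g p) (g p) = 0 := by
    rw [hg.map_null_iff]
    simp [hp, minkowski_single_zero, minkowski_single_of_ne, hi, hi']
    linear_combination r ^ 4 * he
  have hqq : minkowski Q d (g q) (g q) = 0 := by
    rw [hg.map_null_iff]
    simp [hq, minkowski_single_zero, minkowski_single_of_ne, hi, hi']
    linear_combination he
  have h1 : minkowski Q d (g (Pi.single 0 1)) (g (Pi.single 0 1)) +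
        minkowski Q d (g (Pi.single i e)) (g (Pi.single i e)) = 0 := by
    refine (hg.map_self_add_map_self ?_ ?_).1
    all_goals
      simp [minkowski_single_zero, minkowski_single_of_ne, hi, hi']
      linear_combination he
  rw [map_add, minkowski_add_self, hpp, hqq, hs] at h
  simp only [hq, map_add, map_sub, map_smul, LinearMap.smul_apply, LinearMap.add_apply,
    smul_eq_mul, minkowski_comm (g (Pi.single i e)) (g (Pi.single 0 1))] at h
  linear_combination h + 2 * s * h1

/-- The two null vectors `e₀ ± eᵢ` have the same scaling factor, since both factors are read off
from the image of `2r eⱼ` in a third direction. Half the sum and half the difference then separate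
`e₀` from `eᵢ`. -/
theorem exists_map_single_sq (hg : PreservesNull g) (hd : 3 ≤ d) {i : Fin d} (hi : i ≠ 0) (r : Q) :
    ∃ s : Q, g (Pi.single 0 (r ^ 2)) = s • g (Pi.single 0 1) ∧
      g (Pi.single i (r ^ 2)) = s • g (Pi.single i 1) := by
  obtain ⟨j, hj, hij⟩ := exists_ne_zero_ne hd i
  have hC := hg.minkowski_map_single_zero_ne_zero
  have key : ∀ e : Q, e ^ 2 = 1 → ∃ s : Q,
      g (Pi.single 0 (r ^ 2) + Pi.single i (e * r ^ 2)) = s • g (Pi.single 0 1 + Pi.single i e) := by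
    intro e he
    obtain ⟨s, hs⟩ := hg.exists_map_smul_of_null hd (u := Pi.single 0 1 + Pi.single i e) (by
      simp [minkowski_single_zero, minkowski_single_of_ne, hi, hi.symm]
      linear_combination he) (r ^ 2)
    refine ⟨s, hs ▸ ?_⟩
    simp [smul_add, ← Pi.single_smul, mul_comm]
  obtain ⟨s, hs⟩ := key 1 (by norm_num)
  obtain ⟨s', hs'⟩ := key (-1) (by norm_num)
  have h1 := hg.minkowski_map_single_eq_mul hi hj hij (by norm_num) hs
  have h2 := hg.minkowski_map_single_eq_mul hi hj hij (by norm_num) hs'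
  obtain rfl : s = s' := by
    refine mul_right_cancel₀ (mul_ne_zero four_ne_zero hC) (by linear_combination h1 - h2)
  simp only [one_mul, neg_mul, Pi.single_neg, map_add, map_neg, smul_add, smul_neg] at hs hs'
  refine ⟨s, ?_, ?_⟩ <;> refine smul_right_injective _ (two_ne_zero (α := Q)) ?_ <;>
    simp only [two_smul]
  · linear_combination (exp := 1) hs + hs'
  · linear_combination (exp := 1) hs - hs'

/-- Every scalar is a difference of two squares. -/
theorem exists_map_single (hg : PreservesNull g) (hd : 3 ≤ d) {i : Fin d} (hi : i ≠ 0) (a : Q) :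
    ∃ s : Q, g (Pi.single 0 a) = s • g (Pi.single 0 1) ∧
      g (Pi.single i a) = s • g (Pi.single i 1) := by
  obtain ⟨s, h1, h2⟩ := hg.exists_map_single_sq hd hi ((a + 1) / 2)
  obtain ⟨s', h1', h2'⟩ := hg.exists_map_single_sq hd hi ((a - 1) / 2)
  have ha : a = ((a + 1) / 2) ^ 2 - ((a - 1) / 2) ^ 2 := by ring
  refine ⟨s - s', ?_, ?_⟩
  · rw [ha, Pi.single_sub, map_sub, h1, h1', sub_smul]
  · rw [ha, Pi.single_sub, map_sub, h2, h2', sub_smul]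

/-- An additive map preserving lightlike separation is semilinear. -/
theorem exists_ringHom (hg : PreservesNull g) (hd : 3 ≤ d) :
    ∃ σ : Q →+* Q, ∀ (a : Q) (x : Fin d → Q), g (a • x) = σ a • g x := by
  have h0 := hg.map_single_zero_ne_zero
  obtain ⟨i, j, hi, hj, hij⟩ := exists_two_ne_zero hd
  choose σ hσ0 hσi using fun a => hg.exists_map_single hd hi a
  have hσ : ∀ (a : Q) (l : Fin d), g (Pi.single l a) = σ a • g (Pi.single l 1) := by
    intro a l
    by_cases hl : l = 0
    · rw [hl, hσ0]
    · obtain ⟨s, hs, hs'⟩ := hg.exists_map_single hd hl a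
      -- The factor in direction `l` equals the one for `e₀`, so it does not depend on `l`.
      rwa [smul_left_injective _ h0 ((hσ0 a).symm.trans hs)]
  have hone : σ 1 = 1 := smul_left_injective _ h0 (by simp [← hσ0])
  have hadd : ∀ a b, σ (a + b) = σ a + σ b := fun a b =>
    smul_left_injective _ h0 (by simp only [add_smul, ← hσ0, Pi.single_add, map_add])
  have hsq : ∀ r, σ (r ^ 2) = σ r ^ 2 := by
    intro r
    have h1 := hg.minkowski_map_single_eq_mul hi hj hij (e := 1) (by norm_num)
      (r := r) (s := σ (r ^ 2)) (by
        simp only [one_mul, map_add, hσ (r ^ 2), smul_add])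
    have h2 := (hg.minkowski_map_single hj 1).1
    rw [two_mul, hσ, hadd, minkowski_smul_self] at h1
    refine mul_right_cancel₀ (mul_ne_zero four_ne_zero hg.minkowski_map_single_zero_ne_zero) ?_
    linear_combination h1 - 4 * σ r ^ 2 * h2
  -- Additivity and compatibility with squares give multiplicativity by polarization.
  have hmul : ∀ a b, σ (a * b) = σ a * σ b := by
    intro a b
    have h := hsq (a + b)
    rw [show (a + b) ^ 2 = a ^ 2 + b ^ 2 + (a * b + a * b) by ring] at h
    simp only [hadd, hsq] at h
    linarith
  let τ : Q →+* Q := RingHom.mk' ⟨⟨σ, hone⟩, hmul⟩ hadd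
  refine ⟨τ, fun a x => ?_⟩
  let S : AddSubgroup (Fin d → Q) :=
    { carrier := {x | g (a • x) = σ a • g x}
      zero_mem' := by simp
      add_mem' := fun {x y} hx hy => by
        rw [Set.mem_ofPred_eq] at hx hy ⊢
        rw [smul_add, map_add, hx, hy, map_add, smul_add]
      neg_mem' := fun {x} hx => by
        rw [Set.mem_ofPred_eq] at hx ⊢
        rw [smul_neg, map_neg, hx, map_neg, smul_neg] }
  refine mem_of_forall_single_mem S (fun l b => ?_) x
  change g (a • Pi.single l b) = σ a • g (Pi.single l b)
  rw [← Pi.single_smul, hσ, hσ b, smul_smul, smul_eq_mul, hmul]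

/-- The null vector `5e₀ + 3eᵢ + 4eⱼ` has integer coefficients, which `σ` fixes; in the square of
its image the mixed term `24⟨g eᵢ, g eⱼ⟩` is all that remains. -/
theorem minkowski_map_single_single (hg : PreservesNull g) {σ : Q →+* Q}
    (hσ : ∀ (a : Q) (x : Fin d → Q), g (a • x) = σ a • g x) {i j : Fin d} (hi : i ≠ 0)
    (hj : j ≠ 0) (hij : i ≠ j) :
    minkowski Q d (g (Pi.single i 1)) (g (Pi.single j 1)) = 0 := by
  have h : minkowski Q d (g ((5 : Q) • Pi.single 0 1 + (3 : Q) • Pi.single i 1 +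
      (4 : Q) • Pi.single j 1)) (g ((5 : Q) • Pi.single 0 1 + (3 : Q) • Pi.single i 1 +
      (4 : Q) • Pi.single j 1)) = 0 := by
    rw [hg.map_null_iff]
    simp [minkowski_single_zero, minkowski_single_of_ne, hi, hj, hi.symm, hj.symm, hij, hij.symm]
    norm_num
  have h1 := hg.minkowski_map_single hi 1
  have h2 := hg.minkowski_map_single hj 1
  simp only [map_add, hσ, map_ofNat, map_smul, LinearMap.add_apply, LinearMap.smul_apply,
    smul_eq_mul, minkowski_comm _ (g (Pi.single 0 1)), h1.2, h2.2,
    minkowski_comm (g (Pi.single j 1)) (g (Pi.single i 1))] at h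
  linear_combination (h - 9 * h1.1 - 16 * h2.1) / 24

/-- A semilinear map preserving lightlike separation is a semisimilarity of the Minkowski form. -/
theorem exists_minkowski_map (hg : PreservesNull g) {σ : Q →+* Q}
    (hσ : ∀ (a : Q) (x : Fin d → Q), g (a • x) = σ a • g x) :
    ∃ a : Q, ∀ x y, minkowski Q d (g x) (g y) = a * σ (minkowski Q d x y) := by
  have hs : ∀ (i : Fin d) (b : Q), g (Pi.single i b) = σ b • g (Pi.single i 1) := fun i b => by
    rw [← hσ, ← Pi.single_smul, smul_eq_mul, mul_one]
  refine ⟨-minkowski Q d (g (Pi.single 0 1)) (g (Pi.single 0 1)), fun x y => ?_⟩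
  set a := -minkowski Q d (g (Pi.single 0 1)) (g (Pi.single 0 1)) with ha
  let S : (Fin d → Q) → AddSubgroup (Fin d → Q) := fun y =>
    { carrier := {x | minkowski Q d (g x) (g y) = a * σ (minkowski Q d x y)}
      zero_mem' := by simp
      add_mem' := fun {x x'} hx hx' => by
        rw [Set.mem_ofPred_eq] at hx hx' ⊢
        simp only [map_add, LinearMap.add_apply, hx, hx', mul_add]
      neg_mem' := fun {x} hx => by
        rw [Set.mem_ofPred_eq] at hx ⊢
        simp only [map_neg, LinearMap.neg_apply, hx, mul_neg] }
  have hcomm : ∀ x y, x ∈ S y → y ∈ S x := fun x y h => by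
    change minkowski Q d (g y) (g x) = a * σ (minkowski Q d y x)
    rw [minkowski_comm, minkowski_comm y]
    exact h
  refine mem_of_forall_single_mem (S y) (fun i b => hcomm _ _ ?_) x
  refine mem_of_forall_single_mem (S _) (fun j c => ?_) y
  change minkowski Q d (g (Pi.single j c)) (g (Pi.single i b)) =
    a * σ (minkowski Q d (Pi.single j c) (Pi.single i b))
  rw [hs, hs i]
  simp only [map_smul, LinearMap.smul_apply, smul_eq_mul]
  by_cases hj : j = 0
  · rw [hj, minkowski_single_zero]
    by_cases hi : i = 0
    · simp [hi, ha]; ring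
    · simp [Ne.symm hi, (hg.minkowski_map_single hi 1).2]
  · rw [minkowski_single_of_ne hj]
    by_cases hij : j = i
    · subst hij
      have h := (hg.minkowski_map_single hj 1).1
      simp only [Pi.single_eq_same, map_mul]
      linear_combination σ c * σ b * h
    · rw [Pi.single_eq_of_ne hij]
      by_cases hi : i = 0
      · rw [hi, minkowski_comm, (hg.minkowski_map_single hj 1).2]; simp
      · rw [hg.minkowski_map_single_single hσ hj hi hij]; simp

/-- An additive map which preserves lightlike separation, and also distances between events which
remain simultaneous, is a Lorentz transformation. -/
theorem isLorentz (hg : PreservesNull g) (hd : 3 ≤ d)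
    (hs : ∀ x, x 0 = 0 → g x 0 = 0 → minkowski Q d (g x) (g x) = minkowski Q d x x) :
    (∀ (a : Q) (x : Fin d → Q), g (a • x) = a • g x) ∧
      ∀ x, minkowski Q d (g x) (g x) = minkowski Q d x x := by
  obtain ⟨σ, hσ⟩ := hg.exists_ringHom hd
  obtain ⟨a, ha⟩ := hg.exists_minkowski_map hσ
  obtain ⟨i, j, hi, hj, hij⟩ := exists_two_ne_zero hd
  -- The image of a light line fills a whole light line.
  have hsurj : Function.Surjective σ := by
    intro c
    have hu : (Pi.single 0 1 + Pi.single i 1 : Fin d → Q) ≠ 0 := fun h => by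
      simpa [Pi.single_eq_of_ne hi.symm] using congrFun h 0
    obtain ⟨b, hb⟩ := hg.exists_apply_eq_add_smul (o := 0) hu (minkowski_single_add_single hi 1) c
    have hgu : g (Pi.single 0 1 + Pi.single i 1) ≠ 0 := fun h =>
      hu (hg.injective hd (h.trans (map_zero g).symm))
    refine ⟨b, smul_left_injective _ hgu ?_⟩
    simpa [hσ] using hb
  -- A nonzero spatial vector with spatial image exists in the span of `eᵢ` and `eⱼ`: one linear
  -- condition in two unknowns, solvable because `σ` is onto.
  obtain ⟨x, hx, hx0, hgx0⟩ : ∃ x : Fin d → Q, x ≠ 0 ∧ x 0 = 0 ∧ g x 0 = 0 := by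
    by_cases hα : g (Pi.single i 1) 0 = 0
    · exact ⟨Pi.single i 1, by simp, Pi.single_eq_of_ne hi.symm _, hα⟩
    · obtain ⟨b, hb⟩ := hsurj (-g (Pi.single j 1) 0 / g (Pi.single i 1) 0)
      refine ⟨b • Pi.single i 1 + Pi.single j 1, fun h => ?_, ?_, ?_⟩
      · simpa [Pi.single_eq_of_ne hij.symm] using congrFun h j
      · simp [Pi.single_eq_of_ne hi.symm, Pi.single_eq_of_ne hj.symm]
      · rw [map_add, hσ, hb, Pi.add_apply, Pi.smul_apply, smul_eq_mul, div_mul_cancel₀ _ hα,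
          neg_add_cancel]
  have hpos := (minkowski_self_pos hx hx0).ne'
  have hsq : ∀ t, σ t ^ 2 = t ^ 2 := by
    intro t
    have h := hs (t • x) (by simp [hx0]) (by simp [hσ, hgx0])
    rw [hσ, minkowski_smul_self, minkowski_smul_self, hs x hx0 hgx0] at h
    exact mul_right_cancel₀ hpos h
  -- Comparing the squares at `t` and `t + 1` excludes the sign `-1`.
  have hid : ∀ t, σ t = t := by
    intro t
    have h := hsq (t + 1)
    rw [map_add, map_one] at h
    linear_combination (h - hsq t) / 2
  have ha1 : a = 1 := by
    have h := hs x hx0 hgx0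
    rw [ha, hid] at h
    exact mul_right_cancel₀ hpos (by rw [h, one_mul])
  exact ⟨fun a x => by rw [hσ, hid], fun x => by rw [ha, hid, ha1, one_mul]⟩

end PreservesNull

/-! ### Worldview transformations and time dilation. -/

namespace WorldviewModel

variable {B Q : Type*} [Field Q] [LinearOrder Q] [IsStrictOrderedRing Q] {d : ℕ} [NeZero d]
  {M : WorldviewModel B Q d}

/-- Inertial observers see two events on a light signal exactly if they are lightlike separated. -/
theorem SpecRel.exists_photon_iff (hM : M.SpecRel) (hd : 3 ≤ d) {m : B} (hm : M.IOb m)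
    (x y : Fin d → Q) :
    (∃ p, M.Ph p ∧ M.W m p x ∧ M.W m p y) ↔ minkowski Q d (x - y) (x - y) = 0 := by
  obtain ⟨c, -, h⟩ := hM.axPh m hm
  obtain ⟨p, hp, h0, h1⟩ := hM.axSymD.2 m hm
  have hc := (h _ _).1 ⟨p, hp, h0, h1⟩
  have hval : ∀ i : Fin d, i ≠ 0 → ((0 : Q) - if i.val ≤ 1 then 1 else 0) ^ 2 =
      if i = (⟨1, by omega⟩ : Fin d) then 1 else 0 := by
    intro i hi
    have : i.val ≠ 0 := fun h => hi (Fin.ext (by simpa using h))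
    by_cases h1 : i.val = 1
    · simp [h1, Fin.ext_iff]
    · simp [h1, Fin.ext_iff, show ¬ i.val ≤ 1 by omega]
  -- The signal through the origin and `⟨1, 1, 0, …, 0⟩` normalizes the speed of light.
  have hc1 : c ^ 2 = 1 := by
    rw [spaceSq, sum_congr rfl fun i hi => hval i (mem_filter.1 hi).2, sum_ite_eq',
      if_pos (mem_filter.2 ⟨mem_univ _, fun h => one_ne_zero (Fin.ext_iff.1 h)⟩), timeDiff] at hc
    simpa using hc.symm
  rw [h, hc1, one_mul, spaceSq_eq]
  constructor <;> intro h' <;> linarith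

/-- The photons present in an event determine the light cone of its coordinate point, hence the
point. -/
theorem SpecRel.ev_injective (hM : M.SpecRel) (hd : 3 ≤ d) {m : B} (hm : M.IOb m) :
    Function.Injective (M.ev m) := by
  intro x y h
  refine eq_of_forall_null_iff hd fun z => ?_
  rw [← hM.exists_photon_iff hd hm, ← hM.exists_photon_iff hd hm]
  exact exists_congr fun p => and_congr_right fun _ => and_congr_left fun _ =>
    Set.ext_iff.1 h p

/-- The worldview transformation of two inertial observers is a Poincaré transformation. -/
theorem SpecRel.exists_poincare (hM : M.SpecRel) (hd : 3 ≤ d) {k m : B} (hk : M.IOb k)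
    (hm : M.IOb m) : ∃ (f : (Fin d → Q) → (Fin d → Q)) (g : (Fin d → Q) →+ (Fin d → Q)),
      Function.Surjective f ∧ (∀ x, M.ev k x = M.ev m (f x)) ∧ (∀ x y, f x - f y = g (x - y)) ∧
      (∀ (a : Q) (x : Fin d → Q), g (a • x) = a • g x) ∧
      ∀ x, minkowski Q d (g x) (g x) = minkowski Q d x x := by
  choose f hf' using hM.axEv k m hk hm
  have hf : ∀ x, M.ev k x = M.ev m (f x) := fun x => Set.ext (hf' x)
  have hsurj : Function.Surjective f := by
    intro y
    obtain ⟨x, hx⟩ := hM.axEv m k hm hk y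
    exact ⟨x, hM.ev_injective hd hm ((hf x).symm.trans (Set.ext hx).symm)⟩
  have hN : PreservesNull f := by
    refine ⟨hsurj, fun x y => ?_⟩
    rw [← hM.exists_photon_iff hd hm, ← hM.exists_photon_iff hd hk]
    simp only [hf']
  have hfg := hN.apply_sub_apply hd
  obtain ⟨h1, h2⟩ := (hN.addHom_preservesNull hd).isLorentz hd (fun x hx hgx => by
    rw [hN.addHom_apply] at hgx
    have h := hM.axSymD.1 k m hk hm x 0 (f x) (f 0) hx (sub_eq_zero.1 hgx) (hf x) (hf 0)
    rw [spaceSq_eq, spaceSq_eq, sub_zero, timeDiff, timeDiff, sub_eq_zero.1 hgx, hx] at h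
    rw [hN.addHom_apply]
    simpa using h.symm)
  exact ⟨f, hN.addHom hd, hsurj, hf, hfg, h1, h2⟩

end WorldviewModel

/-- Time dilation. The squared speed of `k` according to `m` is well defined, it differs from `1`
(so that the quotient below is a genuine one), and the time dilation formula holds. -/
theorem corollary3p4 {B Q : Type*} [Field Q] [LinearOrder Q] [IsStrictOrderedRing Q]
    {d : ℕ} [NeZero d] (hd : 3 ≤ d) (M : WorldviewModel B Q d) (hM : M.SpecRel)
    (m k : B) (hm : M.IOb m) (hk : M.IOb k) :
    (∃! v : Q, M.SpeedSq m k v) ∧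
    ∀ v : Q, M.SpeedSq m k v → v ≠ 1 ∧
      ∀ x y x' y' : Fin d → Q, x ∈ M.wl k k → y ∈ M.wl k k →
        M.worldview k m x x' → M.worldview k m y y' →
          timeDiff x' y' ^ 2 = timeDiff x y ^ 2 / (1 - v) := by
  obtain ⟨f, g, hsurj, hf, hfg, hsmul, hiso⟩ := hM.exists_poincare hd hk hm
  have hW : ∀ x, M.W m k (f x) ↔ M.W k k x := fun x => (Set.ext_iff.1 (hf x) k).symm
  set T := g (Pi.single 0 1) with hT
  have hTT : minkowski Q d T T = -1 := by
    rw [hT, hiso, minkowski_single_zero]; simp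
  -- A purely spatial `T` would have positive square.
  have hτ : T 0 ≠ 0 := fun h => by
    have hT0 : T ≠ 0 := by intro h'; rw [h'] at hTT; simp at hTT
    have := minkowski_self_pos hT0 h
    linarith
  have hline : ∀ x y, M.W k k x → M.W k k y → f x - f y = timeDiff x y • T := by
    intro x y hx hy
    rw [hfg, hT, ← hsmul, ← Pi.single_smul, smul_eq_mul, mul_one]
    congr 1
    ext i
    by_cases hi : i = 0
    · simp [hi, timeDiff]
    · simp [hi, (hM.axSelf k hk x).1 hx i hi, (hM.axSelf k hk y).1 hy i hi]
  have htime : ∀ x y, M.W k k x → M.W k k y → timeDiff (f x) (f y) = timeDiff x y * T 0 :=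
    fun x y hx hy => congrFun (hline x y hx hy) 0
  have hspace : ∀ x y, M.W k k x → M.W k k y → spaceSq (f x) (f y) =
      timeDiff x y ^ 2 * (T 0 ^ 2 - 1) := fun x y hx hy => by
    rw [spaceSq_eq, hline x y hx hy, minkowski_smul_self, hTT, htime x y hx hy]
    ring
  have hspeed : ∀ v, M.SpeedSq m k v → v * T 0 ^ 2 = T 0 ^ 2 - 1 := by
    rintro v ⟨x', y', hne, hx, hy, hv⟩
    obtain ⟨x, rfl⟩ := hsurj x'
    obtain ⟨y, rfl⟩ := hsurj y'
    rw [hW] at hx hy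
    have ht : timeDiff x y ≠ 0 := fun h => hne (sub_eq_zero.1 (by
      rw [hline x y hx hy, h, zero_smul]))
    rw [hspace x y hx hy, htime x y hx hy] at hv
    exact mul_left_cancel₀ (pow_ne_zero 2 ht) (by linear_combination -hv)
  have hτ2 : T 0 ^ 2 ≠ 0 := pow_ne_zero 2 hτ
  refine ⟨⟨(T 0 ^ 2 - 1) / T 0 ^ 2, ?_, fun v hv => ?_⟩, fun v hv => ?_⟩
  · have hx : M.W k k (Pi.single 0 1) :=
      (hM.axSelf k hk _).2 fun i hi => Pi.single_eq_of_ne hi _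
    have hy : M.W k k 0 := (hM.axSelf k hk _).2 fun i _ => rfl
    have ht : timeDiff (Pi.single 0 1 : Fin d → Q) 0 = 1 := by simp [timeDiff]
    refine ⟨f (Pi.single 0 1), f 0, fun h => ?_, (hW _).2 hx, (hW _).2 hy, ?_⟩
    · have := htime _ _ hx hy
      rw [h, ht, one_mul, timeDiff, sub_self] at this
      exact hτ this.symm
    · rw [hspace _ _ hx hy, htime _ _ hx hy, ht]
      field_simp
  · rw [eq_div_iff hτ2, hspeed v hv]
  · have h := hspeed v hv
    have hv1 : v ≠ 1 := by rintro rfl; linarith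
    refine ⟨hv1, fun x y x' y' hx hy hxx' hyy' => ?_⟩
    obtain rfl := hM.ev_injective hd hm ((hf x).symm.trans hxx'.1)
    obtain rfl := hM.ev_injective hd hm ((hf y).symm.trans hyy'.1)
    rw [htime x y hx hy, eq_div_iff (sub_ne_zero.2 hv1.symm)]
    linear_combination -(timeDiff x y ^ 2) * h
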